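/- A partition is a weakly decreasing sequence $\lambda=(\lambda_1\ge\lambda_2\ge\cdots)$ of nonnegative integers with finitely many nonzero terms; $|\lambda|=\sum_i\lambda_i$, and $k\lambda=(k\lambda_1,k\lambda_2,\ldots)$ for an integer $k\ge 1$. Let $\mathsf{Par}$ be the set of all partitions and let $\mathsf{Par}_2\subseteq\mathsf{Par}$ be the set of partitions with at most two nonzero parts. For $\mu,\nu,\lambda\in\mathsf{Par}$ let $c_{\mu,\nu}^{\lambda}$ be the Littlewood–Richardson coefficient, that is, the number of semistandard tableaux of skew shape $\lambda/\mu$ and content $\nu$ whose row reading word (rows read right to left, from top to bottom) is ballot, meaning that every initial segment contains at least as many $i$'s as $(i+1)$'s for every $i\ge 1$ (it is $0$ if $\mu\not\subseteq\lambda$). The Newell–Littlewood number is $$N_{\mu,\nu,\lambda}=\sum_{\alpha,\beta,\gamma\in\mathsf{Par}} c_{\alpha,\beta}^{\mu}\,c_{\alpha,\gamma}^{\nu}\,c_{\beta,\gamma}^{\lambda},$$ a sum with only finitely many nonzero terms. **Corollary 5.12.** Both Newell–Littlewood saturation conjectures hold for $n=2$. That is, let $\lambda,\mu,\nu\in\mathsf{Par}_2$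 with $|\lambda|+|\mu|+|\nu|\equiv 0\pmod 2$. 1. If $N_{k\mu,k\nu,k\lambda}>0$ for some integer $k\ge 1$, then $N_{\mu,\nu,\lambda}>0$. 2. For every integer $k\ge 1$ with $N_{k\mu,k\nu,k\lambda}>0$ there exist $\alpha,\beta,\gamma\in\mathsf{Par}$ such that $c_{k\alpha,k\beta}^{k\mu}\,c_{k\alpha,k\gamma}^{k\nu}\,c_{k\beta,k\gamma}^{k\lambda}>0$. -/

import Mathlib

namespace NewellLittlewood

/-- The number `ℓ(μ)` of nonzero parts of a partition. Partitions are identified with their Young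
diagrams (English convention, rows and columns indexed from `0`), so the part with index `i`
is `μ.rowLen i` and `ℓ(μ)` is the number of cells in the first column. -/
def numParts (μ : YoungDiagram) : ℕ := μ.colLen 0

/-- The set of partitions with at most `n` nonzero parts. -/
def Par (n : ℕ) : Set YoungDiagram := {μ | numParts μ ≤ n}

/-- The partition `kμ = (kμ₁, kμ₂, …)`. -/
def scale (k : ℕ) (μ : YoungDiagram) : YoungDiagram :=
  YoungDiagram.ofRowLens (μ.rowLens.map (fun m => k * m))
    (List.Pairwise.sortedGE ((YoungDiagram.rowLens_sorted μ).pairwise.map (fun m => k * m)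
      (fun _ _ h => Nat.mul_le_mul_left k h)))

theorem rowLen_scale (k : ℕ) (μ : YoungDiagram) (i : ℕ) :
    (scale k μ).rowLen i = k * μ.rowLen i := by
  by_cases hi : i < μ.colLen 0
  · have h : i < (μ.rowLens.map (fun m => k * m)).length := by simpa using hi
    have := YoungDiagram.rowLen_ofRowLens
      (hw := List.Pairwise.sortedGE ((YoungDiagram.rowLens_sorted μ).pairwise.map (fun m => k * m)
        (fun _ _ h => Nat.mul_le_mul_left k h))) ⟨i, h⟩
    simpa [scale] using this
  · have h0 : μ.rowLen i = 0 := by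
      by_contra h
      exact hi (YoungDiagram.mem_iff_lt_colLen.1
        (YoungDiagram.mem_iff_lt_rowLen.2 (Nat.pos_of_ne_zero h)))
    rw [h0, Nat.mul_zero]
    by_contra h
    have hm : (i, 0) ∈ scale k μ := YoungDiagram.mem_iff_lt_rowLen.2 (Nat.pos_of_ne_zero h)
    obtain ⟨h1, -⟩ := YoungDiagram.mem_ofRowLens.1 hm
    exact hi (by simpa using h1)

/-- The cells of the skew shape `lam/μ`. -/
def skewCells (lam μ : YoungDiagram) : Finset (ℕ × ℕ) := lam.cells \ μ.cells

/-- The part of the row reading word of the skew shape `lam/μ` (rows read right to left, from top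
to bottom) up to and including the cell `c`, as a set of cells. -/
def readUpTo (lam μ : YoungDiagram) (c : ℕ × ℕ) : Finset (ℕ × ℕ) :=
  (skewCells lam μ).filter (fun d => d.1 < c.1 ∨ (d.1 = c.1 ∧ c.2 ≤ d.2))

/-- The Littlewood-Richardson tableaux of shape `lam/μ` and content `ν`: the fillings of `lam/μ`
with positive integers that are semistandard and ballot and in which the integer `i + 1` occurs
as often as the length of the row of `ν` with index `i` says. For extensionality, a filling is a
function on `ℕ × ℕ` that vanishes off the skew shape. There are none if `μ` is not contained
in `lam`. -/
@[ext]
structure LRTableau (μ ν lam : YoungDiagram) where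
  entry : ℕ × ℕ → ℕ
  subset : μ ≤ lam
  zeros : ∀ c, c ∉ skewCells lam μ → entry c = 0
  pos : ∀ c ∈ skewCells lam μ, 1 ≤ entry c
  row_weak : ∀ i j₁ j₂ : ℕ, j₁ < j₂ → (i, j₁) ∈ skewCells lam μ → (i, j₂) ∈ skewCells lam μ →
    entry (i, j₁) ≤ entry (i, j₂)
  col_strict : ∀ i₁ i₂ j : ℕ, i₁ < i₂ → (i₁, j) ∈ skewCells lam μ → (i₂, j) ∈ skewCells lam μ →
    entry (i₁, j) < entry (i₂, j)
  content : ∀ i : ℕ, ((skewCells lam μ).filter (fun c => entry c = i + 1)).card = ν.rowLen i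
  /-- In each initial segment of the row reading word, `i` occurs at least as often
  as `i + 1`. -/
  ballot : ∀ c ∈ skewCells lam μ, ∀ i : ℕ, 1 ≤ i →
    ((readUpTo lam μ c).filter (fun d => entry d = i + 1)).card ≤
      ((readUpTo lam μ c).filter (fun d => entry d = i)).card

/-- The Littlewood-Richardson coefficient `c_{μ,ν}^{lam}` (a number of elements of a finite type,
see the instance below). -/
noncomputable def lrCoeff (μ ν lam : YoungDiagram) : ℕ := Nat.card (LRTableau μ ν lam)

/-- The Newell-Littlewood number
`N_{μ,ν,lam} = ∑_{α,β,γ} c_{α,β}^μ c_{α,γ}^ν c_{β,γ}^{lam}`, the sum being over all triples of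
partitions. Only finitely many terms are nonzero, see `finite_support` below. -/
noncomputable def nlNumber (μ ν lam : YoungDiagram) : ℕ :=
  ∑ᶠ t : YoungDiagram × YoungDiagram × YoungDiagram,
    lrCoeff t.1 t.2.1 μ * lrCoeff t.1 t.2.2 ν * lrCoeff t.2.1 t.2.2 lam

theorem LRTableau.entry_le {μ ν lam : YoungDiagram} (T : LRTableau μ ν lam) (c : ℕ × ℕ) :
    T.entry c ≤ ν.colLen 0 := by
  by_cases hc : c ∈ skewCells lam μ
  · obtain ⟨i, hi⟩ : ∃ i, T.entry c = i + 1 := ⟨T.entry c - 1, by have := T.pos c hc; omega⟩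
    have h : 0 < ν.rowLen i := by
      rw [← T.content i]
      exact Finset.card_pos.2 ⟨c, Finset.mem_filter.2 ⟨hc, hi⟩⟩
    have := YoungDiagram.mem_iff_lt_colLen.1 (YoungDiagram.mem_iff_lt_rowLen.2 h)
    omega
  · rw [T.zeros c hc]; exact Nat.zero_le _

instance (μ ν lam : YoungDiagram) : Finite (LRTableau μ ν lam) := by
  refine Finite.of_injective
    (fun (T : LRTableau μ ν lam) (c : lam.cells) =>
      (⟨T.entry c, Nat.lt_succ_of_le (T.entry_le c)⟩ : Fin (ν.colLen 0 + 1))) ?_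
  intro T U h
  ext c
  by_cases hc : c ∈ lam.cells
  · simpa using congrArg Fin.val (congrFun h ⟨c, hc⟩)
  · have hc' : c ∉ skewCells lam μ := fun h' => hc (Finset.mem_sdiff.1 h').1
    rw [T.zeros c hc', U.zeros c hc']

theorem finite_card_le (n : ℕ) : {μ : YoungDiagram | μ.card ≤ n}.Finite := by
  refine Set.Finite.of_finite_image (f := YoungDiagram.cells) ?_
    (fun _ _ _ _ h => YoungDiagram.ext h)
  refine ((Finset.range n ×ˢ Finset.range n).powerset : Finset (Finset (ℕ × ℕ))).finite_toSet.subset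
    ?_
  rintro _ ⟨μ, hμ, rfl⟩
  refine Finset.mem_coe.2 (Finset.mem_powerset.2 ?_)
  rintro ⟨i, j⟩ hc
  have h1 : μ.rowLen i ≤ μ.card := by
    rw [YoungDiagram.rowLen_eq_card]; exact Finset.card_le_card (Finset.filter_subset _ _)
  have h2 : μ.colLen j ≤ μ.card := by
    rw [YoungDiagram.colLen_eq_card]; exact Finset.card_le_card (Finset.filter_subset _ _)
  have h3 := YoungDiagram.mem_iff_lt_rowLen.1 ((YoungDiagram.mem_cells _).1 hc)
  have h4 := YoungDiagram.mem_iff_lt_colLen.1 ((YoungDiagram.mem_cells _).1 hc)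
  have hμ' : μ.card ≤ n := hμ
  exact Finset.mem_product.2 ⟨Finset.mem_range.2 (by simp only; omega),
    Finset.mem_range.2 (by simp only; omega)⟩

theorem LRTableau.card_le {μ ν lam : YoungDiagram} (T : LRTableau μ ν lam) :
    μ.card ≤ lam.card ∧ ν.card ≤ lam.card := by
  refine ⟨Finset.card_le_card (YoungDiagram.cells_subset_iff.2 T.subset), ?_⟩
  have h1 : ν.card = ∑ i ∈ Finset.range (ν.colLen 0), ν.rowLen i := by
    have := Finset.card_eq_sum_card_fiberwise (s := ν.cells) (t := Finset.range (ν.colLen 0))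
      (f := Prod.fst) (by
        rintro ⟨i, j⟩ hc
        have h := YoungDiagram.mem_iff_lt_colLen.1 ((YoungDiagram.mem_cells _).1 hc)
        have := ν.colLen_anti 0 j (Nat.zero_le _)
        exact Finset.mem_coe.2 (Finset.mem_range.2 (by simp only; omega)))
    rw [YoungDiagram.card, this]
    refine Finset.sum_congr rfl fun i _ => ?_
    rw [YoungDiagram.rowLen_eq_card]; rfl
  rw [h1]
  calc ∑ i ∈ Finset.range (ν.colLen 0), ν.rowLen i
      = ∑ i ∈ Finset.range (ν.colLen 0),
          ((skewCells lam μ).filter (fun c => T.entry c = i + 1)).card :=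
        Finset.sum_congr rfl fun i _ => (T.content i).symm
    _ = ((Finset.range (ν.colLen 0)).biUnion
          fun i => (skewCells lam μ).filter (fun c => T.entry c = i + 1)).card := by
        refine (Finset.card_biUnion ?_).symm
        intro i _ j _ hij
        refine Finset.disjoint_left.2 fun c h h' => hij ?_
        have := (Finset.mem_filter.1 h).2
        have := (Finset.mem_filter.1 h').2
        omega
    _ ≤ lam.cells.card := by
        refine Finset.card_le_card (Finset.biUnion_subset.2 fun i _ => ?_)
        exact (Finset.filter_subset _ _).trans Finset.sdiff_subset

theorem card_le_of_lrCoeff_ne_zero {μ ν lam : YoungDiagram} (h : lrCoeff μ ν lam ≠ 0) :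
    μ.card ≤ lam.card ∧ ν.card ≤ lam.card := by
  obtain ⟨⟨T⟩, -⟩ := Nat.card_ne_zero.1 h
  exact T.card_le

theorem finite_support (μ ν lam : YoungDiagram) :
    (Function.support fun t : YoungDiagram × YoungDiagram × YoungDiagram =>
      lrCoeff t.1 t.2.1 μ * lrCoeff t.1 t.2.2 ν * lrCoeff t.2.1 t.2.2 lam).Finite := by
  refine ((finite_card_le μ.card).prod
    ((finite_card_le μ.card).prod (finite_card_le ν.card))).subset ?_
  rintro ⟨α, β, γ⟩ h
  have h1 := left_ne_zero_of_mul (left_ne_zero_of_mul (Function.mem_support.1 h))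
  have h2 := right_ne_zero_of_mul (left_ne_zero_of_mul (Function.mem_support.1 h))
  exact ⟨(card_le_of_lrCoeff_ne_zero h1).1, (card_le_of_lrCoeff_ne_zero h1).2,
    (card_le_of_lrCoeff_ne_zero h2).2⟩

end NewellLittlewood

open NewellLittlewood

namespace NewellLittlewood

/-! For a two-row `μ`, the coefficient `lrCoeff α β μ` is positive exactly when `α` and `β` have at
most two rows and satisfy the inequalities `Horn` (`lrCoeff_pos_iff`). In terms of sizes and of
differences of the two parts, these say that sizes add and that the three differences satisfy the
triangle inequalities. In a Newell–Littlewood triple the sizes of `α`, `β`, `γ` are therefore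
forced, and they are integers by the parity hypothesis. What remains is a polytope in the three
differences, each bounded by the corresponding size. Dividing a triple for `kμ`, `kν`, `kλ` by `k`
gives a rational point of it. Its coordinatewise maximum is then an integral point with the parities
needed to recover partitions (`exists_int_triangle`). The resulting triple for `μ`, `ν`, `λ` gives
the first claim. It also gives the second, because the Horn conditions are homogeneous. -/

/-! ### Two-row partitions, skew cells and row segments. -/

theorem mem_Par_two_iff {μ : YoungDiagram} : μ ∈ Par 2 ↔ μ.rowLen 2 = 0 := by
  have h : (2, 0) ∈ μ ↔ 2 < μ.colLen 0 := YoungDiagram.mem_iff_lt_colLen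
  have h' : (2, 0) ∈ μ ↔ 0 < μ.rowLen 2 := YoungDiagram.mem_iff_lt_rowLen
  have : μ ∈ Par 2 ↔ μ.colLen 0 ≤ 2 := Iff.rfl
  rw [this]
  have := h.symm.trans h'
  omega

theorem rowLen_eq_zero_of_mem_Par_two {μ : YoungDiagram} (hμ : μ ∈ Par 2) {i : ℕ} (hi : 2 ≤ i) :
    μ.rowLen i = 0 := by
  have := μ.rowLen_anti 2 i hi
  have := mem_Par_two_iff.1 hμ
  omega

theorem scale_mem_Par_two_iff {k : ℕ} (hk : 1 ≤ k) {μ : YoungDiagram} :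
    scale k μ ∈ Par 2 ↔ μ ∈ Par 2 := by
  rw [mem_Par_two_iff, mem_Par_two_iff, rowLen_scale, Nat.mul_eq_zero]
  omega

theorem exists_mem_Par_two {x y : ℕ} (h : y ≤ x) :
    ∃ μ ∈ Par 2, μ.rowLen 0 = x ∧ μ.rowLen 1 = y := by
  have hw : [x, y].SortedGE := List.Pairwise.sortedGE (by simpa using h)
  refine ⟨YoungDiagram.ofRowLens [x, y] hw, ?_, ?_, ?_⟩
  · rw [mem_Par_two_iff]
    by_contra h0
    obtain ⟨h1, -⟩ := YoungDiagram.mem_ofRowLens.1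
      (YoungDiagram.mem_iff_lt_rowLen.2 (Nat.pos_of_ne_zero h0))
    simp at h1
  · exact YoungDiagram.rowLen_ofRowLens (hw := hw) ⟨0, by simp⟩
  · exact YoungDiagram.rowLen_ofRowLens (hw := hw) ⟨1, by simp⟩

theorem card_eq_of_mem_Par_two {μ : YoungDiagram} (hμ : μ ∈ Par 2) :
    μ.card = μ.rowLen 0 + μ.rowLen 1 := by
  have h := Finset.card_eq_sum_card_fiberwise (s := μ.cells) (t := Finset.range 2)
    (f := Prod.fst) (by
      rintro ⟨i, j⟩ hc
      have h := YoungDiagram.mem_iff_lt_rowLen.1 ((YoungDiagram.mem_cells _).1 hc)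
      refine Finset.mem_coe.2 (Finset.mem_range.2 ?_)
      by_contra h2
      rw [rowLen_eq_zero_of_mem_Par_two hμ (not_lt.1 h2)] at h
      omega)
  rw [YoungDiagram.card, h, Finset.sum_range_succ, Finset.sum_range_one,
    YoungDiagram.rowLen_eq_card, YoungDiagram.rowLen_eq_card]
  rfl

theorem mem_skewCells_iff {lam μ : YoungDiagram} {i j : ℕ} :
    (i, j) ∈ skewCells lam μ ↔ μ.rowLen i ≤ j ∧ j < lam.rowLen i := by
  rw [skewCells, Finset.mem_sdiff, YoungDiagram.mem_cells, YoungDiagram.mem_cells,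
    YoungDiagram.mem_iff_lt_rowLen, YoungDiagram.mem_iff_lt_rowLen]
  omega

theorem mem_readUpTo_iff {lam μ : YoungDiagram} {c : ℕ × ℕ} {i j : ℕ} :
    (i, j) ∈ readUpTo lam μ c ↔
      (μ.rowLen i ≤ j ∧ j < lam.rowLen i) ∧ (i < c.1 ∨ (i = c.1 ∧ c.2 ≤ j)) := by
  rw [readUpTo, Finset.mem_filter, mem_skewCells_iff]

theorem rowLen_le_of_le {μ lam : YoungDiagram} (h : μ ≤ lam) (i : ℕ) :
    μ.rowLen i ≤ lam.rowLen i := by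
  by_contra hlt
  push Not at hlt
  have h1 : (i, lam.rowLen i) ∈ μ := YoungDiagram.mem_iff_lt_rowLen.2 hlt
  exact absurd (YoungDiagram.mem_iff_lt_rowLen.1 (h h1)) (lt_irrefl _)

theorem le_of_rowLen_le {μ lam : YoungDiagram} (h : ∀ i, μ.rowLen i ≤ lam.rowLen i) :
    μ ≤ lam := by
  rintro ⟨i, j⟩ hc
  exact YoungDiagram.mem_iff_lt_rowLen.2 ((YoungDiagram.mem_iff_lt_rowLen.1 hc).trans_le (h i))

/-- The cells of a row with column index in `[a, b)`. -/
def rowSegment (i a b : ℕ) : Finset (ℕ × ℕ) := {i} ×ˢ Finset.Ico a b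

theorem mem_rowSegment {i a b : ℕ} {c : ℕ × ℕ} :
    c ∈ rowSegment i a b ↔ c.1 = i ∧ a ≤ c.2 ∧ c.2 < b := by
  rw [rowSegment, Finset.mem_product, Finset.mem_singleton, Finset.mem_Ico]

theorem card_rowSegment (i a b : ℕ) : (rowSegment i a b).card = b - a := by
  simp [rowSegment]

/-! ### Littlewood–Richardson positivity for two rows. -/

namespace LRTableau

variable {α β μ : YoungDiagram}

/-- In the reading word of a ballot tableau, each letter `≥ 2` is preceded by the letter one
smaller. -/
theorem exists_mem_readUpTo (T : LRTableau α β μ) {c : ℕ × ℕ} (hc : c ∈ skewCells μ α)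
    (h2 : 2 ≤ T.entry c) : ∃ d ∈ readUpTo μ α c, T.entry d + 1 = T.entry c := by
  have hb := T.ballot c hc (T.entry c - 1) (by omega)
  have hmem : c ∈ (readUpTo μ α c).filter (fun d => T.entry d = T.entry c - 1 + 1) := by
    rw [Finset.mem_filter, readUpTo, Finset.mem_filter]
    exact ⟨⟨hc, Or.inr ⟨rfl, le_rfl⟩⟩, by omega⟩
  obtain ⟨d, hd⟩ := Finset.card_pos.1 ((Finset.card_pos.2 ⟨c, hmem⟩).trans_le hb)
  rw [Finset.mem_filter] at hd
  exact ⟨d, hd.1, by omega⟩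

/-- The rightmost cell of the row is the first letter read, hence a 1 by ballotness, and it bounds
the rest of the row. -/
theorem entry_row_zero (T : LRTableau α β μ) {j : ℕ} (hj : (0, j) ∈ skewCells μ α) :
    T.entry (0, j) = 1 := by
  have hj' := mem_skewCells_iff.1 hj
  have hl : (0, μ.rowLen 0 - 1) ∈ skewCells μ α := mem_skewCells_iff.2 (by omega)
  have hlast : T.entry (0, μ.rowLen 0 - 1) ≤ 1 := by
    by_contra h
    obtain ⟨⟨i, j'⟩, hd, he⟩ := T.exists_mem_readUpTo hl (by omega)
    have hd' := mem_readUpTo_iff.1 hd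
    simp only at hd'
    obtain rfl : i = 0 := by omega
    obtain rfl : j' = μ.rowLen 0 - 1 := by omega
    omega
  have hp := T.pos _ hj
  rcases (show j ≤ μ.rowLen 0 - 1 by omega).lt_or_eq with h | h
  · have := T.row_weak 0 j _ h hj hl
    omega
  · rw [← h] at hlast
    omega

/-- Before the rightmost cell of this row only 1s have been read, so its entry is at most 2 and
bounds the row. -/
theorem entry_row_one_le (T : LRTableau α β μ) {j : ℕ} (hj : (1, j) ∈ skewCells μ α) :
    T.entry (1, j) ≤ 2 := by
  have hj' := mem_skewCells_iff.1 hj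
  have hl : (1, μ.rowLen 1 - 1) ∈ skewCells μ α := mem_skewCells_iff.2 (by omega)
  have hlast : T.entry (1, μ.rowLen 1 - 1) ≤ 2 := by
    by_contra h
    obtain ⟨⟨i, j'⟩, hd, he⟩ := T.exists_mem_readUpTo hl (by omega)
    have hd' := mem_readUpTo_iff.1 hd
    simp only at hd'
    rcases (show i = 0 ∨ i = 1 by omega) with rfl | rfl
    · have := T.entry_row_zero (mem_skewCells_iff.2 hd'.1)
      omega
    · obtain rfl : j' = μ.rowLen 1 - 1 := by omega
      omega
  rcases (show j ≤ μ.rowLen 1 - 1 by omega).lt_or_eq with h | h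
  · have := T.row_weak 1 j _ h hj hl
    omega
  · rwa [← h] at hlast

end LRTableau

/-- The Horn inequalities for partitions with at most two parts. -/
structure Horn (α β μ : YoungDiagram) : Prop where
  sum : α.rowLen 0 + α.rowLen 1 + (β.rowLen 0 + β.rowLen 1) = μ.rowLen 0 + μ.rowLen 1
  left : α.rowLen 0 + β.rowLen 1 ≤ μ.rowLen 0
  right : α.rowLen 1 + β.rowLen 0 ≤ μ.rowLen 0
  top : μ.rowLen 0 ≤ α.rowLen 0 + β.rowLen 0

theorem LRTableau.horn {α β μ : YoungDiagram} (T : LRTableau α β μ) (hμ : μ ∈ Par 2) :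
    α ∈ Par 2 ∧ β ∈ Par 2 ∧ Horn α β μ := by
  have hle := rowLen_le_of_le T.subset
  have hle0 := hle 0
  have hle1 := hle 1
  have hα01 := α.rowLen_anti 0 1 (by omega)
  have hμ01 := μ.rowLen_anti 0 1 (by omega)
  have hμ2 := mem_Par_two_iff.1 hμ
  have hrow : ∀ i j, (i, j) ∈ skewCells μ α → i = 0 ∨ i = 1 := by
    intro i j h
    have h' := mem_skewCells_iff.1 h
    by_contra hi
    rw [rowLen_eq_zero_of_mem_Par_two hμ (by omega : 2 ≤ i)] at h'
    omega
  have hent : ∀ c ∈ skewCells μ α, T.entry c = 1 ∨ T.entry c = 2 := by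
    rintro ⟨i, j⟩ h
    have hp := T.pos _ h
    rcases hrow i j h with rfl | rfl
    · exact Or.inl (T.entry_row_zero h)
    · have := T.entry_row_one_le h
      omega
  have hc0 := T.content 0
  have hc1 := T.content 1
  have hc2 := T.content 2
  have hsum : β.rowLen 0 + β.rowLen 1 =
      (μ.rowLen 0 - α.rowLen 0) + (μ.rowLen 1 - α.rowLen 1) := by
    rw [← hc0, ← hc1, ← card_rowSegment 0, ← card_rowSegment 1,
      ← Finset.card_union_of_disjoint, ← Finset.card_union_of_disjoint]
    · congr 1
      ext ⟨i, j⟩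
      rw [Finset.mem_union, Finset.mem_union, Finset.mem_filter, Finset.mem_filter,
        mem_rowSegment, mem_rowSegment]
      constructor
      · intro h
        have hm : (i, j) ∈ skewCells μ α := by tauto
        have := mem_skewCells_iff.1 hm
        rcases hrow i j hm with rfl | rfl
        · exact Or.inl ⟨rfl, this⟩
        · exact Or.inr ⟨rfl, this⟩
      · intro h
        have hm : (i, j) ∈ skewCells μ α := by
          rcases h with ⟨h, h'⟩ | ⟨h, h'⟩ <;> simp only at h <;> subst h <;>
            exact mem_skewCells_iff.2 h'
        rcases hent _ hm with h | h
        · exact Or.inl ⟨hm, h⟩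
        · exact Or.inr ⟨hm, h⟩
    · exact Finset.disjoint_left.2 fun c h h' => by
        have := (mem_rowSegment.1 h).1
        have := (mem_rowSegment.1 h').1
        omega
    · exact Finset.disjoint_left.2 fun c h h' => by
        have := (Finset.mem_filter.1 h).2
        have := (Finset.mem_filter.1 h').2
        omega
  have htop : μ.rowLen 0 - α.rowLen 0 ≤ β.rowLen 0 := by
    rw [← hc0, ← card_rowSegment 0]
    refine Finset.card_le_card ?_
    rintro ⟨i, j⟩ h
    obtain ⟨rfl, h⟩ := mem_rowSegment.1 h
    have hm := mem_skewCells_iff.2 h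
    exact Finset.mem_filter.2 ⟨hm, T.entry_row_zero hm⟩
  -- Columns from `α.rowLen 0` to `μ.rowLen 1` have skew cells in both rows, so column strictness
  -- forces a 2 below. With the sum condition this is `Horn.right`.
  have hright : μ.rowLen 1 - α.rowLen 0 ≤ β.rowLen 1 := by
    rw [← hc1, ← card_rowSegment 1]
    refine Finset.card_le_card ?_
    rintro ⟨i, j⟩ h
    obtain ⟨rfl, h⟩ := mem_rowSegment.1 h
    simp only at h
    have hm : (1, j) ∈ skewCells μ α := mem_skewCells_iff.2 (by omega)
    have hm0 : (0, j) ∈ skewCells μ α := mem_skewCells_iff.2 (by omega)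
    have h1 := T.col_strict 0 1 j (by omega) hm0 hm
    have h2 := T.pos _ hm0
    have h3 := T.entry_row_one_le hm
    exact Finset.mem_filter.2 ⟨hm, by omega⟩
  have hleft : β.rowLen 1 ≤ μ.rowLen 0 - α.rowLen 0 := by
    rcases ((skewCells μ α).filter (fun c => T.entry c = 1 + 1)).eq_empty_or_nonempty with h | h
    · rw [h, Finset.card_empty] at hc1
      omega
    -- At the leftmost 2 every 2 has been read, while the 1s read so far all lie in the top row;
    -- ballotness there gives the bound.
    · obtain ⟨⟨i, j⟩, hc, hmin⟩ := Finset.exists_min_image _ Prod.snd h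
      obtain ⟨hcs, hce⟩ := Finset.mem_filter.1 hc
      have hrow1 : ∀ i j, (i, j) ∈ skewCells μ α → T.entry (i, j) = 2 → i = 1 := by
        intro i j h h2
        rcases hrow i j h with rfl | rfl
        · rw [T.entry_row_zero h] at h2
          omega
        · rfl
      obtain rfl := hrow1 i j hcs hce
      have hb := T.ballot _ hcs 1 le_rfl
      rw [← hc1, ← card_rowSegment 0]
      refine (Finset.card_le_card ?_).trans (hb.trans (Finset.card_le_card ?_))
      · rintro ⟨i', j'⟩ h'
        have hj := hmin _ h'
        obtain ⟨hs, he⟩ := Finset.mem_filter.1 h'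
        obtain rfl := hrow1 i' j' hs he
        exact Finset.mem_filter.2
          ⟨mem_readUpTo_iff.2 ⟨mem_skewCells_iff.1 hs, Or.inr ⟨rfl, hj⟩⟩, he⟩
      · rintro ⟨i', j'⟩ h'
        obtain ⟨hs, he⟩ := Finset.mem_filter.1 h'
        have hs' := mem_readUpTo_iff.1 hs
        simp only at hs'
        have hm := mem_skewCells_iff.2 hs'.1
        rcases hs'.2 with h0 | ⟨rfl, hjj⟩
        · obtain rfl : i' = 0 := by omega
          exact mem_rowSegment.2 ⟨rfl, hs'.1⟩
        · rcases hjj.lt_or_eq with hlt | rfl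
          · have := T.row_weak 1 j j' hlt hcs hm
            omega
          · omega
  refine ⟨mem_Par_two_iff.2 ?_, mem_Par_two_iff.2 ?_, ?_⟩
  · have := hle 2
    omega
  · rw [← hc2, Finset.card_eq_zero, Finset.filter_eq_empty_iff]
    intro c hc
    have := hent c hc
    omega
  · constructor <;> omega

/-- The Littlewood-Richardson tableau with `1`s in the first row and `β₂` letters `2` at the end of
the second row. -/
def Horn.tableau {α β μ : YoungDiagram} (hα : α ∈ Par 2) (hβ : β ∈ Par 2) (hμ : μ ∈ Par 2)
    (h : Horn α β μ) : LRTableau α β μ := by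
  have hα01 := α.rowLen_anti 0 1 (by omega)
  have hμ01 := μ.rowLen_anti 0 1 (by omega)
  have hsum := h.sum
  have hleft := h.left
  have hright := h.right
  have htop := h.top
  have hrow : ∀ i j, (i, j) ∈ skewCells μ α → i = 0 ∨ i = 1 := by
    intro i j h
    have h' := mem_skewCells_iff.1 h
    by_contra hi
    rw [rowLen_eq_zero_of_mem_Par_two hμ (by omega : 2 ≤ i)] at h'
    omega
  let e : ℕ × ℕ → ℕ := fun c =>
    if c ∈ skewCells μ α then if c.1 = 1 ∧ μ.rowLen 1 ≤ c.2 + β.rowLen 1 then 2 else 1 else 0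
  have he : ∀ c ∈ skewCells μ α,
      e c = if c.1 = 1 ∧ μ.rowLen 1 ≤ c.2 + β.rowLen 1 then 2 else 1 :=
    fun c hc => if_pos hc
  have htwo : (skewCells μ α).filter (fun c => e c = 2) =
      rowSegment 1 (μ.rowLen 1 - β.rowLen 1) (μ.rowLen 1) := by
    ext ⟨i, j⟩
    rw [Finset.mem_filter, mem_rowSegment]
    constructor
    · rintro ⟨hm, h2⟩
      rw [he _ hm] at h2
      have hm' := mem_skewCells_iff.1 hm
      obtain ⟨rfl, h3⟩ : i = 1 ∧ μ.rowLen 1 ≤ j + β.rowLen 1 := by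
        by_contra h3
        rw [if_neg h3] at h2
        omega
      exact ⟨rfl, by simp only; omega, hm'.2⟩
    · rintro ⟨h1, h2⟩
      simp only at h1 h2
      subst h1
      have hm : (1, j) ∈ skewCells μ α := mem_skewCells_iff.2 (by omega)
      refine ⟨hm, ?_⟩
      rw [he _ hm]
      exact if_pos ⟨rfl, by simp only; omega⟩
  have hone : (skewCells μ α).filter (fun c => e c = 1) =
      rowSegment 0 (α.rowLen 0) (μ.rowLen 0) ∪
        rowSegment 1 (α.rowLen 1) (μ.rowLen 1 - β.rowLen 1) := by
    ext ⟨i, j⟩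
    rw [Finset.mem_filter, Finset.mem_union, mem_rowSegment, mem_rowSegment]
    constructor
    · rintro ⟨hm, h2⟩
      rw [he _ hm] at h2
      have hm' := mem_skewCells_iff.1 hm
      rcases hrow i j hm with rfl | rfl
      · exact Or.inl ⟨rfl, hm'⟩
      · have h3 : ¬ μ.rowLen 1 ≤ j + β.rowLen 1 := by
          intro h3
          rw [if_pos ⟨rfl, h3⟩] at h2
          omega
        exact Or.inr ⟨rfl, hm'.1, by simp only; omega⟩
    · rintro (⟨h1, h2⟩ | ⟨h1, h2⟩)
      · simp only at h1 h2
        subst h1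
        have hm : (0, j) ∈ skewCells μ α := mem_skewCells_iff.2 (by omega)
        refine ⟨hm, ?_⟩
        rw [he _ hm, if_neg]
        simp
      · simp only at h1 h2
        subst h1
        have hm : (1, j) ∈ skewCells μ α := mem_skewCells_iff.2 (by omega)
        refine ⟨hm, ?_⟩
        rw [he _ hm, if_neg]
        simp only
        omega
  have hle2 : ∀ c, e c ≤ 2 := by
    intro c
    simp only [e]
    split_ifs <;> omega
  refine ⟨e, ?_, ?_, ?_, ?_, ?_, ?_, ?_⟩
  · refine le_of_rowLen_le fun i => ?_
    rcases (show i = 0 ∨ i = 1 ∨ 2 ≤ i by omega) with rfl | rfl | hi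
    · omega
    · omega
    · rw [rowLen_eq_zero_of_mem_Par_two hα hi]
      exact Nat.zero_le _
  · exact fun c hc => if_neg hc
  · intro c hc
    rw [he c hc]
    split_ifs <;> omega
  · intro i j₁ j₂ hj h1 h2
    rw [he _ h1, he _ h2]
    simp only
    split_ifs <;> omega
  · intro i₁ i₂ j hi h1 h2
    rw [he _ h1, he _ h2]
    have h1' := mem_skewCells_iff.1 h1
    have h2' := mem_skewCells_iff.1 h2
    obtain rfl : i₁ = 0 := by
      have := hrow _ _ h1
      have := hrow _ _ h2
      omega
    obtain rfl : i₂ = 1 := by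
      have := hrow _ _ h2
      omega
    simp only
    -- A column with two skew cells has index at least `α.rowLen 0`; by `hright` and `hsum` its
    -- lower cell lies among the final `β.rowLen 1` cells.
    rw [if_neg (by omega), if_pos ⟨trivial, by omega⟩]
    omega
  · intro i
    rcases (show i = 0 ∨ i = 1 ∨ 2 ≤ i by omega) with rfl | rfl | hi
    · rw [zero_add, hone, Finset.card_union_of_disjoint, card_rowSegment, card_rowSegment]
      · omega
      · exact Finset.disjoint_left.2 fun c h h' => by
          have := (mem_rowSegment.1 h).1
          have := (mem_rowSegment.1 h').1
          omega
    · rw [one_add_one_eq_two, htwo, card_rowSegment]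
      omega
    · rw [rowLen_eq_zero_of_mem_Par_two hβ hi, Finset.card_eq_zero, Finset.filter_eq_empty_iff]
      intro c _
      have := hle2 c
      omega
  · rintro ⟨i, j⟩ hc m hm
    by_cases hm1 : m = 1
    · subst hm1
      rcases hrow i j hc with rfl | rfl
      · refine (Finset.card_eq_zero.2 ?_).trans_le (Nat.zero_le _)
        rw [Finset.filter_eq_empty_iff]
        rintro ⟨i', j'⟩ hd
        have hd' := mem_readUpTo_iff.1 hd
        rw [he _ (mem_skewCells_iff.2 hd'.1)]
        simp only at hd' ⊢
        rw [if_neg (by omega)]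
        omega
      -- The whole top row of 1s is read before any 2, and by `hleft` it is at least as long as the
      -- number of 2s.
      · calc _ ≤ ((skewCells μ α).filter (fun c => e c = 2)).card :=
              Finset.card_le_card (Finset.filter_subset_filter _ (Finset.filter_subset _ _))
          _ ≤ (rowSegment 0 (α.rowLen 0) (μ.rowLen 0)).card := by
              rw [htwo, card_rowSegment, card_rowSegment]
              omega
          _ ≤ _ := by
              refine Finset.card_le_card ?_
              rintro ⟨i', j'⟩ hd
              have hd1 : (i', j') ∈ (skewCells μ α).filter (fun c => e c = 1) := by
                rw [hone]
                exact Finset.mem_union_left _ hd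
              obtain ⟨h1, h2⟩ := Finset.mem_filter.1 hd1
              obtain ⟨rfl, -⟩ := mem_rowSegment.1 hd
              exact Finset.mem_filter.2
                ⟨mem_readUpTo_iff.2 ⟨mem_skewCells_iff.1 h1, Or.inl Nat.zero_lt_one⟩, h2⟩
    · refine (Finset.card_eq_zero.2 ?_).trans_le (Nat.zero_le _)
      rw [Finset.filter_eq_empty_iff]
      intro c _
      have := hle2 c
      omega

theorem lrCoeff_pos_iff {α β μ : YoungDiagram} (hμ : μ ∈ Par 2) :
    0 < lrCoeff α β μ ↔ α ∈ Par 2 ∧ β ∈ Par 2 ∧ Horn α β μ := by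
  rw [lrCoeff, Nat.card_pos_iff]
  constructor
  · rintro ⟨⟨T⟩, -⟩
    exact T.horn hμ
  · rintro ⟨hα, hβ, h⟩
    exact ⟨⟨h.tableau hα hβ hμ⟩, inferInstance⟩

theorem Horn.scale {α β μ : YoungDiagram} (h : Horn α β μ) (k : ℕ) :
    Horn (scale k α) (scale k β) (scale k μ) := by
  obtain ⟨h1, h2, h3, h4⟩ := h
  constructor <;> simp only [rowLen_scale, ← mul_add]
  · rw [h1]
  all_goals exact Nat.mul_le_mul_left k ‹_›

/-! ### Newell–Littlewood positivity and the polytope of differences. -/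

theorem nlNumber_pos_iff {μ ν lam : YoungDiagram} :
    0 < nlNumber μ ν lam ↔
      ∃ α β γ, 0 < lrCoeff α β μ * lrCoeff α γ ν * lrCoeff β γ lam := by
  constructor
  · intro h
    by_contra! h0
    exact h.ne' (finsum_eq_zero_of_forall_eq_zero fun t => Nat.le_zero.1 (h0 t.1 t.2.1 t.2.2))
  · rintro ⟨α, β, γ, h⟩
    -- Finiteness is essential: `finsum` is 0 on infinite support.
    exact finsum_pos (fun _ => Nat.zero_le _) ⟨(α, β, γ), h⟩ (finite_support μ ν lam)

/-- If the polytope of triples `(a, b, c)` with `0 ≤ a ≤ A`, `0 ≤ b ≤ B`, `0 ≤ c ≤ C` such that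
`(a, b, m)`, `(a, c, n)`, `(b, c, l)` satisfy the triangle inequalities has a rational point, then
it has an integral point congruent to `(A, B, C)` modulo `2`: its coordinatewise maximum. -/
theorem exists_int_triangle {k A B C m n l a b c : ℤ} (hk : 1 ≤ k)
    (hm : 0 ≤ m) (hn : 0 ≤ n) (hl : 0 ≤ l)
    (pm : (A + B + m) % 2 = 0) (pn : (A + C + n) % 2 = 0) (pl : (B + C + l) % 2 = 0)
    (ha0 : 0 ≤ a) (hb0 : 0 ≤ b) (hc0 : 0 ≤ c) (ha : a ≤ k * A) (hb : b ≤ k * B) (hc : c ≤ k * C)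
    (hab : a ≤ b + k * m) (hba : b ≤ a + k * m) (hac : a ≤ c + k * n) (hca : c ≤ a + k * n)
    (hbc : b ≤ c + k * l) (hcb : c ≤ b + k * l)
    (sm : k * m ≤ a + b) (sn : k * n ≤ a + c) (sl : k * l ≤ b + c) :
    ∃ a' b' c' : ℤ, (0 ≤ a' ∧ a' ≤ A ∧ (A + a') % 2 = 0) ∧ (0 ≤ b' ∧ b' ≤ B ∧ (B + b') % 2 = 0) ∧
      (0 ≤ c' ∧ c' ≤ C ∧ (C + c') % 2 = 0) ∧
      (a' ≤ b' + m ∧ b' ≤ a' + m ∧ m ≤ a' + b') ∧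
      (a' ≤ c' + n ∧ c' ≤ a' + n ∧ n ≤ a' + c') ∧
      (b' ≤ c' + l ∧ c' ≤ b' + l ∧ l ≤ b' + c') := by
  have hk0 : 0 < k := by omega
  -- The maximum of one coordinate is the least of five bounds: its own size bound, and the size
  -- bound of another coordinate carried over by one or two triangle inequalities.
  have key : ∀ x X Y Z u v w : ℤ, x ≤ k * X → x ≤ k * (Y + u) → x ≤ k * (Z + v) →
      x ≤ k * (Z + w + u) → x ≤ k * (Y + w + v) →
      ∃ y, x ≤ k * y ∧ (y ≤ X ∧ y ≤ Y + u ∧ y ≤ Z + v ∧ y ≤ Z + w + u ∧ y ≤ Y + w + v) ∧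
        (y = X ∨ y = Y + u ∨ y = Z + v ∨ y = Z + w + u ∨ y = Y + w + v) := by
    intro x X Y Z u v w h1 h2 h3 h4 h5
    refine ⟨min (min X (Y + u)) (min (Z + v) (min (Z + w + u) (Y + w + v))), ?_, ?_, ?_⟩
    · simp only [mul_min_of_nonneg _ _ hk0.le, le_min_iff]
      exact ⟨⟨h1, h2⟩, h3, h4, h5⟩
    · clear h1 h2 h3 h4 h5
      omega
    · clear h1 h2 h3 h4 h5
      omega
  obtain ⟨a', ka, ⟨a1, a2, a3, a4, a5⟩, ea⟩ :=
    key a A B C m n l ha (by linarith) (by linarith) (by linarith) (by linarith)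
  obtain ⟨b', kb, ⟨b1, b2, b3, b4, b5⟩, eb⟩ :=
    key b B A C m l n hb (by linarith) (by linarith) (by linarith) (by linarith)
  obtain ⟨c', kc, ⟨c1, c2, c3, c4, c5⟩, ec⟩ :=
    key c C A B n l m hc (by linarith) (by linarith) (by linarith) (by linarith)
  have ha' : 0 ≤ a' := nonneg_of_mul_nonneg_right (ha0.trans ka) hk0
  have hb' : 0 ≤ b' := nonneg_of_mul_nonneg_right (hb0.trans kb) hk0
  have hc' : 0 ≤ c' := nonneg_of_mul_nonneg_right (hc0.trans kc) hk0
  -- Lower bounds on sums survive because the maximum dominates the given rational point.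
  have sm' : m ≤ a' + b' := le_of_mul_le_mul_left (by linarith) hk0
  have sn' : n ≤ a' + c' := le_of_mul_le_mul_left (by linarith) hk0
  have sl' : l ≤ b' + c' := le_of_mul_le_mul_left (by linarith) hk0
  clear key ha hb hc hab hba hac hca hbc hcb sm sn sl ka kb kc ha0 hb0 hc0
  refine ⟨a', b', c', ⟨ha', a1, ?_⟩, ⟨hb', b1, ?_⟩, ⟨hc', c1, ?_⟩, ⟨?_, ?_, sm'⟩, ⟨?_, ?_, sn'⟩,
    ?_, ?_, sl'⟩
  -- All five candidates for the minimum are congruent to `A` modulo 2.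
  · clear eb ec; omega
  · clear ea ec; omega
  · clear ea eb; omega
  -- Whichever bound `b'` attains, adding `m` gives at least one of the bounds on `a'`, since `m`,
  -- `n`, `l` are nonnegative. The other difference inequalities are similar.
  · clear ea ec; omega
  · clear eb ec; omega
  · clear ea eb; omega
  · clear eb ec; omega
  · clear ea eb; omega
  · clear ea ec; omega

/-! ### Descent from the scaled triple. -/

theorem exists_horn_of_scale {μ ν lam : YoungDiagram}
    (hE : Even (lam.rowLen 0 + lam.rowLen 1 + (μ.rowLen 0 + μ.rowLen 1) +
      (ν.rowLen 0 + ν.rowLen 1)))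
    {k : ℕ} (hk : 1 ≤ k) {α β γ : YoungDiagram} (h1 : Horn α β (scale k μ))
    (h2 : Horn α γ (scale k ν)) (h3 : Horn β γ (scale k lam)) :
    ∃ α' ∈ Par 2, ∃ β' ∈ Par 2, ∃ γ' ∈ Par 2, Horn α' β' μ ∧ Horn α' γ' ν ∧ Horn β' γ' lam := by
  have hα := α.rowLen_anti 0 1 (by omega)
  have hβ := β.rowLen_anti 0 1 (by omega)
  have hγ := γ.rowLen_anti 0 1 (by omega)
  have hμ := μ.rowLen_anti 0 1 (by omega)
  have hν := ν.rowLen_anti 0 1 (by omega)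
  have hl := lam.rowLen_anti 0 1 (by omega)
  obtain ⟨s1, l1, r1, t1⟩ := h1
  obtain ⟨s2, l2, r2, t2⟩ := h2
  obtain ⟨s3, l3, r3, t3⟩ := h3
  simp only [rowLen_scale] at *
  generalize α.rowLen 0 = α₀ at *
  generalize α.rowLen 1 = α₁ at *
  generalize β.rowLen 0 = β₀ at *
  generalize β.rowLen 1 = β₁ at *
  generalize γ.rowLen 0 = γ₀ at *
  generalize γ.rowLen 1 = γ₁ at *
  generalize eμ₀ : μ.rowLen 0 = μ₀ at *
  generalize eμ₁ : μ.rowLen 1 = μ₁ at *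
  generalize eν₀ : ν.rowLen 0 = ν₀ at *
  generalize eν₁ : ν.rowLen 1 = ν₁ at *
  generalize el₀ : lam.rowLen 0 = l₀ at *
  generalize el₁ : lam.rowLen 1 = l₁ at *
  obtain ⟨S, hS⟩ := hE
  zify at *
  have hk0 : (0 : ℤ) < k := by omega
  -- `S` is half the total size; `A`, `B`, `C` are the sizes forced on the three new partitions by
  -- additivity.
  obtain ⟨A, hA⟩ : ∃ A : ℤ, A = S - l₀ - l₁ := ⟨_, rfl⟩
  obtain ⟨B, hB⟩ : ∃ B : ℤ, B = S - ν₀ - ν₁ := ⟨_, rfl⟩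
  obtain ⟨C, hC⟩ : ∃ C : ℤ, C = S - μ₀ - μ₁ := ⟨_, rfl⟩
  have kS := congrArg (fun x : ℤ => (k : ℤ) * x) hS
  simp only [mul_add] at kS
  obtain ⟨a, b, c, ⟨a0, aA, pa⟩, ⟨b0, bB, pb⟩, ⟨c0, cC, pc⟩, ⟨m1, m2, m3⟩, ⟨n1, n2, n3⟩,
    q1, q2, q3⟩ := exists_int_triangle (k := k) (A := A) (B := B) (C := C) (m := μ₀ - μ₁)
      (n := ν₀ - ν₁) (l := l₀ - l₁) (a := α₀ - α₁) (b := β₀ - β₁) (c := γ₀ - γ₁) hk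
      (by omega) (by omega) (by omega) (by omega) (by omega) (by omega) (by omega) (by omega)
      (by omega)
      (by rw [hA]; simp only [mul_sub]; linarith) (by rw [hB]; simp only [mul_sub]; linarith)
      (by rw [hC]; simp only [mul_sub]; linarith)
      (by rw [mul_sub]; linarith) (by rw [mul_sub]; linarith) (by rw [mul_sub]; linarith)
      (by rw [mul_sub]; linarith) (by rw [mul_sub]; linarith) (by rw [mul_sub]; linarith)
      (by rw [mul_sub]; linarith) (by rw [mul_sub]; linarith) (by rw [mul_sub]; linarith)
  -- Size `X` and difference `x` determine the parts `(X + x) / 2` and `(X - x) / 2`; parity makes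
  -- them integral.
  have mk : ∀ X x : ℤ, 0 ≤ x → x ≤ X → (X + x) % 2 = 0 →
      ∃ ρ ∈ Par 2, (ρ.rowLen 0 : ℤ) + ρ.rowLen 1 = X ∧ (ρ.rowLen 0 : ℤ) - ρ.rowLen 1 = x := by
    intro X x h0 h1 h2
    obtain ⟨ρ, hρ, e0, e1⟩ := exists_mem_Par_two
      (show ((X - x) / 2).toNat ≤ ((X + x) / 2).toNat by omega)
    exact ⟨ρ, hρ, by omega, by omega⟩
  obtain ⟨α', hα', ea, ea'⟩ := mk A a a0 aA pa
  obtain ⟨β', hβ', eb, eb'⟩ := mk B b b0 bB pb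
  obtain ⟨γ', hγ', ec, ec'⟩ := mk C c c0 cC pc
  refine ⟨α', hα', β', hβ', γ', hγ', ?_, ?_, ?_⟩ <;> constructor <;> omega

theorem exists_horn_of_nlNumber_scale_pos {μ ν lam : YoungDiagram} (hμ : μ ∈ Par 2)
    (hν : ν ∈ Par 2) (hl : lam ∈ Par 2) (hE : Even (lam.card + μ.card + ν.card))
    {k : ℕ} (hk : 1 ≤ k) (h : 0 < nlNumber (scale k μ) (scale k ν) (scale k lam)) :
    ∃ α ∈ Par 2, ∃ β ∈ Par 2, ∃ γ ∈ Par 2, Horn α β μ ∧ Horn α γ ν ∧ Horn β γ lam := by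
  obtain ⟨α, β, γ, h⟩ := nlNumber_pos_iff.1 h
  rw [card_eq_of_mem_Par_two hμ, card_eq_of_mem_Par_two hν, card_eq_of_mem_Par_two hl] at hE
  simp only [Nat.pos_iff_ne_zero, mul_ne_zero_iff] at h
  simp only [← Nat.pos_iff_ne_zero] at h
  rw [lrCoeff_pos_iff ((scale_mem_Par_two_iff hk).2 hμ),
    lrCoeff_pos_iff ((scale_mem_Par_two_iff hk).2 hν),
    lrCoeff_pos_iff ((scale_mem_Par_two_iff hk).2 hl)] at h
  exact exists_horn_of_scale hE hk h.1.1.2.2 h.1.2.2.2 h.2.2.2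

end NewellLittlewood

open NewellLittlewood
/-- Both Newell-Littlewood saturation conjectures hold for partitions with at most two parts. -/
theorem corollary5p12 :
    (∀ μ ∈ Par 2, ∀ ν ∈ Par 2, ∀ lam ∈ Par 2, Even (lam.card + μ.card + ν.card) →
      (∃ k : ℕ, 1 ≤ k ∧ 0 < nlNumber (scale k μ) (scale k ν) (scale k lam)) →
      0 < nlNumber μ ν lam) ∧
    (∀ μ ∈ Par 2, ∀ ν ∈ Par 2, ∀ lam ∈ Par 2, Even (lam.card + μ.card + ν.card) →
      ∀ k : ℕ, 1 ≤ k → 0 < nlNumber (scale k μ) (scale k ν) (scale k lam) →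
        ∃ α β γ : YoungDiagram,
          0 < lrCoeff (scale k α) (scale k β) (scale k μ) *
              lrCoeff (scale k α) (scale k γ) (scale k ν) *
              lrCoeff (scale k β) (scale k γ) (scale k lam)) := by
  constructor
  · rintro μ hμ ν hν lam hl hE ⟨k, hk, h⟩
    obtain ⟨α, hα, β, hβ, γ, hγ, h1, h2, h3⟩ :=
      exists_horn_of_nlNumber_scale_pos hμ hν hl hE hk h
    exact nlNumber_pos_iff.2 ⟨α, β, γ, Nat.mul_pos (Nat.mul_pos
      ((lrCoeff_pos_iff hμ).2 ⟨hα, hβ, h1⟩) ((lrCoeff_pos_iff hν).2 ⟨hα, hγ, h2⟩))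
      ((lrCoeff_pos_iff hl).2 ⟨hβ, hγ, h3⟩)⟩
  · intro μ hμ ν hν lam hl hE k hk h
    obtain ⟨α, hα, β, hβ, γ, hγ, h1, h2, h3⟩ :=
      exists_horn_of_nlNumber_scale_pos hμ hν hl hE hk h
    replace hα := (scale_mem_Par_two_iff hk).2 hα
    replace hβ := (scale_mem_Par_two_iff hk).2 hβ
    replace hγ := (scale_mem_Par_two_iff hk).2 hγ
    exact ⟨α, β, γ, Nat.mul_pos (Nat.mul_pos
      ((lrCoeff_pos_iff ((scale_mem_Par_two_iff hk).2 hμ)).2 ⟨hα, hβ, h1.scale k⟩)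
      ((lrCoeff_pos_iff ((scale_mem_Par_two_iff hk).2 hν)).2 ⟨hα, hγ, h2.scale k⟩))
      ((lrCoeff_pos_iff ((scale_mem_Par_two_iff hk).2 hl)).2 ⟨hβ, hγ, h3.scale k⟩)⟩
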